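/- Let $n,m,p,\ell$ be nonnegative integers with $\ell\le p$, put $I:=\{1,\dots,\ell\}$ and $J:=\{\ell+1,\dots,p\}$, and equip $\mathbb R^n$, $\mathbb R^m$ with the Euclidean norm. Let $h_1,\dots,h_p\colon\mathbb R^n\times\mathbb R^m\to\mathbb R$ be functions and define $$\Gamma(x):=\{y\in\mathbb R^m \mid h_i(x,y)\le 0\ (i\in I),\ h_i(x,y)=0\ (i\in J)\},\qquad \operatorname{dom}\Gamma:=\{x\in\mathbb R^n\mid \Gamma(x)\ne\varnothing\}.$$ Fix $\bar x\in\operatorname{dom}\Gamma$, and assume that on some open neighborhood of $\{\bar x\}\times\Gamma(\bar x)$ all functions $h_1,\dots,h_p$ are continuous and differentiable with respect to $y$, with $\nabla_y h_i$ jointly continuous in $(x,y)$. Assume further: * **(A1)** for each $x\in\mathbb R^n$, the functions $h_i(x,\cdot)\colon\mathbb R^m\to\mathbb R$ are convex for $i\in I$ and affine for $i\in J$; * **(A2)** $\Gamma$ is locally bounded at $\bar x$, i.e. there are a bounded set $B\subset\mathbb R^m$ and a neighborhood $V$ of $\bar x$ with $\Gamma(x)\subset B$ for all $x\in V$; * for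 each $\bar y\in\Gamma(\bar x)$, the relaxed constant positive linear dependence constraint qualification (RCPLD) holds at $(\bar x,\bar y)$ with respect to $\operatorname{dom}\Gamma$, i.e. there are a neighborhood $U$ of $(\bar x,\bar y)$ and an index set $S\subset J$ such that 1. the family $(\nabla_y h_i(\bar x,\bar y))_{i\in S}$ is a basis of the span of $(\nabla_y h_i(\bar x,\bar y))_{i\in J}$; 2. the family $(\nabla_y h_i(x,y))_{i\in J}$ has constant rank on $U\cap(\operatorname{dom}\Gamma\times\mathbb R^m)$; 3. for each $K\subset\{i\in I\mid h_i(\bar x,\bar y)=0\}$ for which there are reals $\alpha_i\ge 0$ ($i\in K$) and $\beta_i$ ($i\in S$), not all zero, with $\sum_{i\in K}\alpha_i\nabla_y h_i(\bar x,\bar y)+\sum_{i\in S}\beta_i\nabla_y h_i(\bar x,\bar y)=0$, the family $(\nabla_y h_i(x,y))_{i\in K\cup S}$ is linearly dependent for each $(x,y)\in U\cap(\operatorname{dom}\Gamma\times\mathbb R^m)$. Then $\Gamma$ is lower semicontinuous at $\bar x$ with respect to $\operatorname{dom}\Gamma$: for each open set $O\subset\mathbb R^m$ with $\Gamma(\bar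 x)\cap O\ne\varnothing$ there is a neighborhood $V$ of $\bar x$ such that $\Gamma(x)\cap O\ne\varnothing$ for all $x\in V\cap\operatorname{dom}\Gamma$. -/

import Mathlib

open Set Filter Topology

noncomputable section

namespace ParamConstraint

/-- The index set `I = {1, …, ℓ}` of the inequality constraints (zero-based: `i < ℓ`). -/
def ineqIdx (p ℓ : ℕ) : Finset (Fin p) := Finset.univ.filter fun i => (i : ℕ) < ℓ

/-- The index set `J = {ℓ + 1, …, p}` of the equality constraints (zero-based: `ℓ ≤ i`). -/
def eqIdx (p ℓ : ℕ) : Finset (Fin p) := Finset.univ.filter fun i => ℓ ≤ (i : ℕ)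

variable {X : Type*} {m p : ℕ}

/-- The domain of a set-valued mapping. -/
def dom {Y : Type*} (Υ : X → Set Y) : Set X := {x | (Υ x).Nonempty}

/-- Local boundedness of a set-valued mapping at a point. -/
def LocallyBoundedAt [TopologicalSpace X] {Y : Type*} [Bornology Y]
    (Υ : X → Set Y) (xbar : X) : Prop :=
  ∃ B : Set Y, Bornology.IsBounded B ∧ ∃ U ∈ 𝓝 xbar, ∀ x ∈ U, Υ x ⊆ B

/-- The feasible-set mapping
`Γ x = {y | h i (x, y) ≤ 0 for i ∈ I, h i (x, y) = 0 for i ∈ J}`. -/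
def Gam (ℓ : ℕ) (h : Fin p → X → EuclideanSpace ℝ (Fin m) → ℝ) (x : X) :
    Set (EuclideanSpace ℝ (Fin m)) :=
  {y | (∀ i ∈ ineqIdx p ℓ, h i x y ≤ 0) ∧ (∀ i ∈ eqIdx p ℓ, h i x y = 0)}

/-- The partial gradient `∇_y h i (x, y)`. -/
def gradY (h : Fin p → X → EuclideanSpace ℝ (Fin m) → ℝ) (i : Fin p) (x : X)
    (y : EuclideanSpace ℝ (Fin m)) : EuclideanSpace ℝ (Fin m) :=
  gradient (fun y' => h i x y') y

/-- The functions `h i` are continuous, and continuously differentiable with respect to `y`, on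
some neighborhood of the set `C`: there `h i` is jointly continuous, differentiable in `y`, and
its partial gradient is jointly continuous. -/
def SmoothInYNear [TopologicalSpace X] (h : Fin p → X → EuclideanSpace ℝ (Fin m) → ℝ)
    (C : Set (X × EuclideanSpace ℝ (Fin m))) : Prop :=
  ∃ W : Set (X × EuclideanSpace ℝ (Fin m)), IsOpen W ∧ C ⊆ W ∧ ∀ i : Fin p,
    ContinuousOn (fun z : X × EuclideanSpace ℝ (Fin m) => h i z.1 z.2) W ∧
    (∀ z ∈ W, DifferentiableAt ℝ (fun y => h i z.1 y) z.2) ∧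
    ContinuousOn (fun z : X × EuclideanSpace ℝ (Fin m) => gradY h i z.1 z.2) W

/-- The set `I(x, y)` of the indices of inequality constraints that are active at `(x, y)`. -/
def activeIdx (ℓ : ℕ) (h : Fin p → X → EuclideanSpace ℝ (Fin m) → ℝ) (x : X)
    (y : EuclideanSpace ℝ (Fin m)) : Set (Fin p) :=
  {i | i ∈ ineqIdx p ℓ ∧ h i x y = 0}

/-- Positive-linear dependence of a pair of finite families of vectors. -/
def PosLinDep {E I₁ I₂ : Type*} [AddCommGroup E] [Module ℝ E] [Fintype I₁] [Fintype I₂]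
    (a : I₁ → E) (b : I₂ → E) : Prop :=
  ∃ (α : I₁ → ℝ) (β : I₂ → ℝ), (∀ i, 0 ≤ α i) ∧ (α ≠ 0 ∨ β ≠ 0) ∧
    ∑ i, α i • a i + ∑ i, β i • b i = 0

/-- The relaxed constant positive linear dependence constraint qualification at
`(xbar, ybar)` with respect to `Ω`. -/
def RCPLD [TopologicalSpace X] (ℓ : ℕ) (h : Fin p → X → EuclideanSpace ℝ (Fin m) → ℝ)
    (Ω : Set X) (xbar : X) (ybar : EuclideanSpace ℝ (Fin m)) : Prop :=
  ∃ U ∈ 𝓝 (xbar, ybar), ∃ S ⊆ eqIdx p ℓ,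
    -- the gradients with indices in `S` form a basis of the span of those with indices in `J`
    (LinearIndependent ℝ (fun i : S => gradY h i xbar ybar) ∧
      Submodule.span ℝ (range fun i : S => gradY h i xbar ybar) =
        Submodule.span ℝ (range fun i : eqIdx p ℓ => gradY h i xbar ybar)) ∧
    -- the gradients with indices in `J` have constant rank on `U ∩ (Ω × ℝᵐ)`
    (∃ r : ℕ, ∀ z ∈ U ∩ Ω ×ˢ (univ : Set (EuclideanSpace ℝ (Fin m))),
      Module.finrank ℝ
        (Submodule.span ℝ (range fun i : eqIdx p ℓ => gradY h i z.1 z.2)) = r) ∧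
    -- positive-linear dependence at the reference point forces linear dependence nearby
    (∀ K : Finset (Fin p), (K : Set (Fin p)) ⊆ activeIdx ℓ h xbar ybar →
      PosLinDep (fun i : K => gradY h i xbar ybar) (fun i : S => gradY h i xbar ybar) →
      ∀ z ∈ U ∩ Ω ×ˢ (univ : Set (EuclideanSpace ℝ (Fin m))),
        ¬ LinearIndependent ℝ (fun i : (K ∪ S : Finset (Fin p)) => gradY h i z.1 z.2))

end ParamConstraint

end

/-! If lower semicontinuity fails at `ybar`, there are `u k → xbar` in the domain whose feasible
sets miss `O`. Projecting `ybar` onto these sets by a quadratic penalty needs no multiplier rule at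
`u k`: some penalized minimizer `z k` lies within `1 / (k + 1)` of a feasible `w k`
(`exists_isMinOn_penalized`). By local boundedness both converge along an ultrafilter to some `ws`,
which is feasible at `xbar` by convexity (`mem_Gam_of_tendsto`).

The claim is `ws = ybar`, which puts some `w k` in `O`. Stationarity writes `ybar - z k` as a
combination of gradients, with nonnegative weights on violated inequalities. Constant rank and
Carathéodory make these gradients linearly independent. Normalized weights converge to `s • (ybar -
ws) = ∑ d i • ∇h i`. If `s = 0`, this is a positive linear dependence, and RCPLD contradicts the
independence at `(u k, z k)`. If `s > 0`, pairing with `ybar - ws` and using convexity gives `‖ybar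
- ws‖ ^ 2 ≤ 0` (`eq_of_tendsto_minimizers`). -/

section Penalty

/-! ### Quadratic penalization of a projection problem. -/

/-- The derivative of the squared positive part. -/
theorem hasDerivAt_max_zero_sq (t : ℝ) :
    HasDerivAt (fun s : ℝ => max s 0 ^ 2) (2 * max t 0) t := by
  rcases lt_trichotomy t 0 with ht | rfl | ht
  · rw [max_eq_right ht.le, mul_zero]
    refine (hasDerivAt_const t (0 : ℝ)).congr_of_eventuallyEq ?_
    filter_upwards [Iio_mem_nhds ht] with s hs
    simp [max_eq_right (mem_Iio.1 hs).le]
  · rw [hasDerivAt_iff_isLittleO_nhds_zero]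
    have h : (fun s : ℝ => max s 0 ^ 2) =O[𝓝 0] fun s : ℝ => s ^ 2 := by
      refine Asymptotics.IsBigO.of_bound 1 (Eventually.of_forall fun s => ?_)
      rw [one_mul, norm_pow, norm_pow]
      gcongr
      rw [Real.norm_eq_abs, Real.norm_eq_abs, abs_of_nonneg (le_max_right s 0)]
      exact max_le (le_abs_self s) (abs_nonneg s)
    simpa using h.trans_isLittleO (Asymptotics.isLittleO_pow_id one_lt_two)
  · rw [max_eq_left ht.le]
    refine HasDerivAt.congr_of_eventuallyEq (by simpa using hasDerivAt_pow 2 t) ?_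
    filter_upwards [Ioi_mem_nhds ht] with s hs
    rw [max_eq_left (mem_Ioi.1 hs).le]

variable {E ι : Type*}

/-- The quadratic penalty of the constraints `f i ≤ 0` for `i ∈ I` and `f i = 0` for `i ∈ J`. -/
def quadraticPenalty (I J : Finset ι) (f : ι → E → ℝ) (y : E) : ℝ :=
  ∑ i ∈ I, max (f i y) 0 ^ 2 + ∑ i ∈ J, f i y ^ 2

theorem quadraticPenalty_nonneg (I J : Finset ι) (f : ι → E → ℝ) (y : E) :
    0 ≤ quadraticPenalty I J f y := by
  unfold quadraticPenalty; positivity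

theorem quadraticPenalty_eq_zero_iff {I J : Finset ι} {f : ι → E → ℝ} {y : E} :
    quadraticPenalty I J f y = 0 ↔ (∀ i ∈ I, f i y ≤ 0) ∧ ∀ i ∈ J, f i y = 0 := by
  unfold quadraticPenalty
  rw [add_eq_zero_iff_of_nonneg (by positivity) (by positivity),
    Finset.sum_eq_zero_iff_of_nonneg (fun _ _ => by positivity),
    Finset.sum_eq_zero_iff_of_nonneg (fun _ _ => by positivity)]
  simp

theorem continuous_quadraticPenalty [TopologicalSpace E] {I J : Finset ι} {f : ι → E → ℝ}
    (hI : ∀ i ∈ I, Continuous (f i)) (hJ : ∀ i ∈ J, Continuous (f i)) :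
    Continuous (quadraticPenalty I J f) :=
  (continuous_finsetSum _ fun i hi => ((hI i hi).max continuous_const).pow 2).add
    (continuous_finsetSum _ fun i hi => (hJ i hi).pow 2)

variable [NormedAddCommGroup E] [InnerProductSpace ℝ E]

/-- Quadratic penalization of the projection problem has minimizers arbitrarily close to the
feasible set. -/
theorem exists_isMinOn_penalized [FiniteDimensional ℝ E] {I J : Finset ι} {f : ι → E → ℝ}
    (hI : ∀ i ∈ I, Continuous (f i)) (hJ : ∀ i ∈ J, Continuous (f i)) (a : E)
    (hne : {y | (∀ i ∈ I, f i y ≤ 0) ∧ ∀ i ∈ J, f i y = 0}.Nonempty) {ε : ℝ} (hε : 0 < ε) :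
    ∃ ρ : ℝ, 0 ≤ ρ ∧ ∃ z w : E,
      IsMinOn (fun y => ‖y - a‖ ^ 2 + ρ * quadraticPenalty I J f y) univ z ∧
      ((∀ i ∈ I, f i w ≤ 0) ∧ ∀ i ∈ J, f i w = 0) ∧ dist z w < ε := by
  obtain ⟨w₀, hw₀⟩ := hne
  set P := quadraticPenalty I J f with hP
  have hPc : Continuous P := continuous_quadraticPenalty hI hJ
  have hP0 : P w₀ = 0 := quadraticPenalty_eq_zero_iff.2 hw₀
  set R := ‖w₀ - a‖ with hR
  set C := {y | (∀ i ∈ I, f i y ≤ 0) ∧ ∀ i ∈ J, f i y = 0} with hC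
  have hA : IsCompact (Metric.closedBall a R ∩ {y | ∀ w ∈ C, ε ≤ dist y w}) := by
    refine (isCompact_closedBall a R).inter_right ?_
    simp only [ofPred_forall]
    exact isClosed_biInter fun w _ =>
      isClosed_le continuous_const (continuous_id.dist continuous_const)
  -- The penalty vanishes only on `C`, so compactness bounds it below on the points of the ball that
  -- are `ε`-far from `C`.
  obtain ⟨c, hc, hcP⟩ : ∃ c : ℝ, 0 < c ∧
      ∀ y ∈ Metric.closedBall a R ∩ {y | ∀ w ∈ C, ε ≤ dist y w}, c ≤ P y := by
    rcases (Metric.closedBall a R ∩ {y | ∀ w ∈ C, ε ≤ dist y w}).eq_empty_or_nonempty with h | h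
    · exact ⟨1, one_pos, by simp [h]⟩
    · obtain ⟨y, hy, hmin⟩ := hA.exists_isMinOn h hPc.continuousOn
      refine ⟨P y, lt_of_le_of_ne (quadraticPenalty_nonneg _ _ _ _) fun h0 => ?_,
        fun y' hy' => hmin hy'⟩
      have := hy.2 y (quadraticPenalty_eq_zero_iff.1 h0.symm)
      rw [dist_self] at this
      linarith
  -- With this weight the penalty term is at least `R ^ 2 + 1` on the `ε`-far points of the ball,
  -- exceeding `F w₀ = R ^ 2`.
  refine ⟨(R ^ 2 + 1) / c, by positivity, ?_⟩
  set F := fun y => ‖y - a‖ ^ 2 + (R ^ 2 + 1) / c * P y with hF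
  have hFc : Continuous F := by fun_prop
  have hw₀R : w₀ ∈ Metric.closedBall a R := by simp [hR, dist_eq_norm]
  have hF0 : F w₀ = R ^ 2 := by simp [hF, hP0, hR]
  obtain ⟨z, hz, hmin⟩ := (isCompact_closedBall a R).exists_isMinOn ⟨w₀, hw₀R⟩ hFc.continuousOn
  have hzw : F z ≤ R ^ 2 := hF0 ▸ hmin hw₀R
  have hpen : ∀ y, 0 ≤ (R ^ 2 + 1) / c * P y := fun y =>
    mul_nonneg (by positivity) (quadraticPenalty_nonneg _ _ _ _)
  have hglob : IsMinOn F univ z := by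
    intro y _
    by_cases hy : y ∈ Metric.closedBall a R
    · exact hmin hy
    · rw [Metric.mem_closedBall, dist_eq_norm, not_le] at hy
      have h1 : R ^ 2 ≤ ‖y - a‖ ^ 2 := by gcongr
      exact hzw.trans (h1.trans (le_add_of_nonneg_right (hpen y)))
  by_cases hzA : ∀ w ∈ C, ε ≤ dist z w
  · have h1 : (R ^ 2 + 1) / c * c ≤ (R ^ 2 + 1) / c * P z := by
      have := hcP z ⟨hz, hzA⟩
      gcongr
    rw [div_mul_cancel₀ _ hc.ne'] at h1
    have h2 : 0 ≤ ‖z - a‖ ^ 2 := by positivity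
    have h3 : ‖z - a‖ ^ 2 + (R ^ 2 + 1) / c * P z ≤ R ^ 2 := hzw
    linarith
  · push Not at hzA
    obtain ⟨w, hw, hzw⟩ := hzA
    exact ⟨z, w, hglob, hw, hzw⟩

/-- The stationarity condition at a minimizer of the quadratic penalty problem. -/
theorem stationary_of_isMinOn_penalized [CompleteSpace E] {I J : Finset ι} {f : ι → E → ℝ}
    {a z : E} {ρ : ℝ} (hI : ∀ i ∈ I, DifferentiableAt ℝ (f i) z)
    (hJ : ∀ i ∈ J, DifferentiableAt ℝ (f i) z)
    (hz : IsMinOn (fun y => ‖y - a‖ ^ 2 + ρ * quadraticPenalty I J f y) univ z) :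
    ∑ i ∈ I, (ρ * max (f i z) 0) • gradient (f i) z + ∑ i ∈ J, (ρ * f i z) • gradient (f i) z
      = a - z := by
  have h1 : ∀ i ∈ I, HasFDerivAt (fun y => max (f i y) 0 ^ 2)
      ((2 * max (f i z) 0) • InnerProductSpace.toDual ℝ E (gradient (f i) z)) z := fun i hi =>
    (hasDerivAt_max_zero_sq (f i z)).comp_hasFDerivAt z (hI i hi).hasGradientAt.hasFDerivAt
  have h2 : ∀ i ∈ J, HasFDerivAt (fun y => f i y ^ 2)
      ((2 * f i z) • InnerProductSpace.toDual ℝ E (gradient (f i) z)) z := fun i hi => by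
    have h : HasDerivAt (fun s : ℝ => s ^ 2) (2 * f i z) (f i z) := by
      simpa using hasDerivAt_pow 2 (f i z)
    exact h.comp_hasFDerivAt z (hJ i hi).hasGradientAt.hasFDerivAt
  have h3 : HasFDerivAt (fun y => ‖y - a‖ ^ 2)
      (2 • InnerProductSpace.toDual ℝ E (z - a)) z := by
    refine ((hasFDerivAt_id z).sub_const a).norm_sq.congr_fderiv ?_
    ext v; simp
  have h4 := h3.add (((HasFDerivAt.fun_sum h1).add (HasFDerivAt.fun_sum h2)).const_mul ρ)
  have h5 := (hz.isLocalMin univ_mem).hasFDerivAt_eq_zero h4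
  have h6 : InnerProductSpace.toDual ℝ E ((2 : ℝ) • (∑ i ∈ I, (ρ * max (f i z) 0) • gradient (f i) z +
      ∑ i ∈ J, (ρ * f i z) • gradient (f i) z - (a - z))) = 0 := by
    rw [← h5]
    simp only [map_smul, map_add, map_sub, map_sum, smul_add, smul_sub, Finset.smul_sum,
      smul_smul, mul_left_comm ρ 2]
    module
  rw [map_eq_zero_iff _ (LinearIsometryEquiv.injective _), smul_eq_zero] at h6
  exact sub_eq_zero.1 (h6.resolve_left two_ne_zero)

/-- The gradient inequality for convex functions. -/
theorem ConvexOn.inner_gradient_le [CompleteSpace E] {f : E → ℝ} (hf : ConvexOn ℝ univ f) {z : E}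
    (hd : DifferentiableAt ℝ f z) (y : E) : inner ℝ (gradient f z) (y - z) ≤ f y - f z := by
  have h := (hd.hasGradientAt.hasFDerivAt.hasLineDerivAt (y - z)).tendsto_slope_zero_right
  rw [InnerProductSpace.toDual_apply_apply] at h
  refine le_of_tendsto h ?_
  filter_upwards [Ioo_mem_nhdsGT (zero_lt_one' ℝ)] with t ht
  have hc := hf.2 (mem_univ z) (mem_univ y) (sub_nonneg.2 ht.2.le) ht.1.le (by ring)
  have he : (1 - t) • z + t • y = z + t • (y - z) := by
    rw [smul_sub, sub_smul, one_smul]; abel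
  rw [he, smul_eq_mul, smul_eq_mul] at hc
  rw [smul_eq_mul]
  rw [inv_mul_le_iff₀ ht.1]
  linarith

end Penalty

/-! ### Conic Carathéodory reduction. -/

section Caratheodory

variable {E ι : Type*} [AddCommGroup E] [Module ℝ E] [DecidableEq ι]

/-- Conic Carathéodory reduction relative to a linearly independent family indexed by `S`. -/
theorem exists_subset_linearIndepOn_of_nonneg {v : ι → E} {S : Finset ι}
    (hS : LinearIndepOn ℝ v (S : Set ι)) (T : Finset ι) (hTS : Disjoint T S) (c : ι → ℝ)
    (hc : ∀ i ∈ T, 0 ≤ c i) :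
    ∃ K ⊆ T, LinearIndepOn ℝ v ((K ∪ S : Finset ι) : Set ι) ∧ ∃ d : ι → ℝ, (∀ i ∈ K, 0 ≤ d i) ∧
      ∑ i ∈ K ∪ S, d i • v i = ∑ i ∈ T ∪ S, c i • v i := by
  induction hn : T.card using Nat.strong_induction_on generalizing T c with
  | _ n ih =>
  by_cases hli : LinearIndepOn ℝ v ((T ∪ S : Finset ι) : Set ι)
  · exact ⟨T, subset_rfl, hli, c, hc, rfl⟩
  -- Independence over `S` forces a dependence to involve `T`; a sign change makes one coefficient
  -- there positive.
  obtain ⟨g, hg, i₁, hi₁, hgi⟩ : ∃ g : ι → ℝ, ∑ i ∈ T ∪ S, g i • v i = 0 ∧ ∃ i ∈ T, 0 < g i := by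
    rw [linearIndepOn_finset_iff] at hli hS
    push Not at hli
    obtain ⟨g, hg, i, hi, hgi⟩ := hli
    have hT : ∃ j ∈ T, g j ≠ 0 := by
      by_contra! h0
      rw [Finset.sum_union hTS, Finset.sum_eq_zero (fun j hj => by rw [h0 j hj, zero_smul]),
        zero_add] at hg
      rcases Finset.mem_union.1 hi with h | h
      · exact hgi (h0 i h)
      · exact hgi (hS g hg i h)
    obtain ⟨j, hj, hgj⟩ := hT
    rcases lt_or_gt_of_ne hgj with h | h
    · refine ⟨-g, by simp [hg], j, hj, by simpa using h⟩
    · exact ⟨g, hg, j, hj, h⟩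
  -- The minimal ratio is the largest multiple of `g` that can be subtracted while keeping the
  -- weights on `T` nonnegative; it cancels `j`.
  obtain ⟨j, hj, hmin⟩ := (T.filter fun i => 0 < g i).exists_min_image (fun i => c i / g i)
    ⟨i₁, Finset.mem_filter.2 ⟨hi₁, hgi⟩⟩
  obtain ⟨hjT, hgj⟩ := Finset.mem_filter.1 hj
  have ht : 0 ≤ c j / g j := div_nonneg (hc j hjT) hgj.le
  obtain ⟨K, hK, hKli, d, hd, hsum⟩ := ih (T.erase j).card
    (hn ▸ Finset.card_erase_lt_of_mem hjT) (T.erase j)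
    (hTS.mono_left (Finset.erase_subset j T)) (fun i => c i - c j / g j * g i) (by
      intro i hi
      have hiT := Finset.mem_of_mem_erase hi
      rw [sub_nonneg]
      rcases lt_or_ge 0 (g i) with h | h
      · have := hmin i (Finset.mem_filter.2 ⟨hiT, h⟩)
        rwa [le_div_iff₀ h] at this
      · exact (mul_nonpos_of_nonneg_of_nonpos ht h).trans (hc i hiT)) rfl
  refine ⟨K, hK.trans (Finset.erase_subset j T), hKli, d, hd, hsum.trans ?_⟩
  have hjS : j ∉ S := Finset.disjoint_left.1 hTS hjT
  rw [show T.erase j ∪ S = (T ∪ S).erase j by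
    rw [Finset.erase_union_distrib, Finset.erase_eq_of_notMem hjS],
    Finset.sum_erase _ (by rw [div_mul_cancel₀ _ hgj.ne', sub_self, zero_smul])]
  simp only [sub_smul, Finset.sum_sub_distrib, mul_smul, ← Finset.smul_sum, hg, smul_zero, sub_zero]

end Caratheodory

/-! ### Multipliers and their normalized limits. -/

section Multipliers

variable {E ι κ : Type*} [NormedAddCommGroup E] [InnerProductSpace ℝ E]

/-- Multipliers at a minimizer of the quadratic penalty problem, chosen with a linearly independent
family of gradients. -/
theorem exists_multipliers_of_isMinOn_penalized [CompleteSpace E] [DecidableEq ι]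
    {I J S : Finset ι} {f : ι → E → ℝ} {a z : E} {ρ : ℝ} (hρ : 0 ≤ ρ) (hIJ : Disjoint I J)
    (hSJ : S ⊆ J) (hI : ∀ i ∈ I, DifferentiableAt ℝ (f i) z)
    (hJ : ∀ i ∈ J, DifferentiableAt ℝ (f i) z)
    (hS : LinearIndepOn ℝ (fun i => gradient (f i) z) (S : Set ι))
    (hspan : ∀ i ∈ J, gradient (f i) z ∈ Submodule.span ℝ ((fun i => gradient (f i) z) '' S))
    (hz : IsMinOn (fun y => ‖y - a‖ ^ 2 + ρ * quadraticPenalty I J f y) univ z) :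
    ∃ K ⊆ I, (∀ i ∈ K, 0 < f i z) ∧
      LinearIndepOn ℝ (fun i => gradient (f i) z) ((K ∪ S : Finset ι) : Set ι) ∧
      ∃ d : ι → ℝ, (∀ i ∈ K, 0 ≤ d i) ∧ (∀ i ∉ K ∪ S, d i = 0) ∧
        ∑ i ∈ K ∪ S, d i • gradient (f i) z = a - z := by
  have hstat := stationary_of_isMinOn_penalized hI hJ hz
  have hmem : ∑ i ∈ J, (ρ * f i z) • gradient (f i) z ∈
      Submodule.span ℝ ((fun i => gradient (f i) z) '' S) :=
    Submodule.sum_mem _ fun i hi => Submodule.smul_mem _ _ (hspan i hi)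
  rw [Submodule.mem_span_image_finset_iff_exists_fun] at hmem
  obtain ⟨e', he'⟩ := hmem
  obtain ⟨e, he⟩ : ∃ e : ι → ℝ, ∑ i ∈ S, e i • gradient (f i) z =
      ∑ i ∈ J, (ρ * f i z) • gradient (f i) z := by
    refine ⟨Function.extend Subtype.val e' 0, ?_⟩
    rw [← Finset.sum_coe_sort, ← he']
    simp
  have hTS : Disjoint (I.filter fun i => 0 < f i z) S :=
    hIJ.mono (Finset.filter_subset _ _) hSJ
  obtain ⟨K, hK, hli, d, hd, hsum⟩ := exists_subset_linearIndepOn_of_nonneg hS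
    (I.filter fun i => 0 < f i z) hTS (fun i => if i ∈ S then e i else ρ * max (f i z) 0)
    fun i hi => by
      rw [if_neg (Finset.disjoint_left.1 hTS hi)]
      exact mul_nonneg hρ (le_max_right _ _)
  have hKI : ∀ i ∈ K, i ∈ I ∧ 0 < f i z := fun i hi => Finset.mem_filter.1 (hK hi)
  -- Zero weights off `K ∪ S` make the norm of the whole vector `d` measure only the multipliers in
  -- use.
  refine ⟨K, fun i hi => (hKI i hi).1, fun i hi => (hKI i hi).2, hli,
    fun i => if i ∈ K ∪ S then d i else 0, fun i hi => ?_, fun i hi => if_neg hi, ?_⟩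
  · simpa only [if_pos (Finset.mem_union_left S hi)] using hd i hi
  · have hT : ∑ i ∈ K ∪ S, (if i ∈ K ∪ S then d i else 0) • gradient (f i) z =
        ∑ i ∈ K ∪ S, d i • gradient (f i) z :=
      Finset.sum_congr rfl fun i hi => by rw [if_pos hi]
    rw [hT, hsum, Finset.sum_union hTS, ← hstat]
    congr 1
    · rw [Finset.sum_filter]
      refine Finset.sum_congr rfl fun i hi => ?_
      rw [if_neg fun h => Finset.disjoint_left.1 hIJ hi (hSJ h)]
      split_ifs with h
      · rfl
      · rw [max_eq_right (not_lt.1 h), mul_zero, zero_smul]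
    · rw [← he]
      refine Finset.sum_congr rfl fun i hi => ?_
      rw [if_pos hi]

/-- Normalized limits of multipliers along an ultrafilter. -/
theorem exists_normalized_limit_multipliers [Fintype ι] (l : Ultrafilter κ) {v : κ → ι → E}
    {vs : ι → E} (hv : ∀ i, Tendsto (fun k => v k i) l (𝓝 (vs i))) {b : κ → E} {bs : E}
    (hb : Tendsto b l (𝓝 bs)) {K T : Finset ι}
    (h : ∀ᶠ k in (l : Filter κ), ∃ d : ι → ℝ, (∀ i ∈ K, 0 ≤ d i) ∧ (∀ i ∉ T, d i = 0) ∧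
      ∑ i ∈ T, d i • v k i = b k) :
    ∃ (s : ℝ) (d : ι → ℝ), 0 ≤ s ∧ s + ‖d‖ = 1 ∧ (∀ i ∈ K, 0 ≤ d i) ∧ (∀ i ∉ T, d i = 0) ∧
      ∑ i ∈ T, d i • vs i = s • bs := by
  have h' : ∀ᶠ k in (l : Filter κ), ∃ q : ℝ × (ι → ℝ), 0 ≤ q.1 ∧ q.1 + ‖q.2‖ = 1 ∧
      (∀ i ∈ K, 0 ≤ q.2 i) ∧ (∀ i ∉ T, q.2 i = 0) ∧ ∑ i ∈ T, q.2 i • v k i = q.1 • b k := by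
    filter_upwards [h] with k ⟨d, hd, hd0, hsum⟩
    have hpos : 0 < 1 + ‖d‖ := by positivity
    -- The weight of `b k` becomes part of the normalized vector, so unbounded multipliers
    -- correspond to a limit with `s = 0`.
    refine ⟨((1 + ‖d‖)⁻¹, (1 + ‖d‖)⁻¹ • d), by positivity, ?_, fun i hi => ?_, fun i hi => ?_, ?_⟩
    · rw [norm_smul, Real.norm_of_nonneg (by positivity)]
      field_simp
    · exact mul_nonneg (by positivity) (hd i hi)
    · simp [hd0 i hi]
    · simp [← hsum, Finset.smul_sum, smul_smul]
  obtain ⟨q, hq⟩ := h'.choice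
  have hball : ∀ᶠ k in (l : Filter κ), q k ∈ Metric.closedBall (0 : ℝ × (ι → ℝ)) 1 := by
    filter_upwards [hq] with k hk
    rw [mem_closedBall_zero_iff, Prod.norm_def, Real.norm_of_nonneg hk.1]
    exact max_le (by linarith [norm_nonneg (q k).2]) (by linarith)
  obtain ⟨⟨s, d⟩, -, hlim⟩ := (isCompact_closedBall (0 : ℝ × (ι → ℝ)) 1).ultrafilter_le_nhds
    (l.map q) (le_principal_iff.2 hball)
  have hlim' : Tendsto q l (𝓝 (s, d)) := hlim
  have hs : Tendsto (fun k => (q k).1) l (𝓝 s) := (continuous_fst.tendsto _).comp hlim'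
  have hd : Tendsto (fun k => (q k).2) l (𝓝 d) := (continuous_snd.tendsto _).comp hlim'
  have hdi : ∀ i, Tendsto (fun k => (q k).2 i) l (𝓝 (d i)) := tendsto_pi_nhds.1 hd
  refine ⟨s, d, ge_of_tendsto hs (hq.mono fun k hk => hk.1),
    tendsto_nhds_unique_of_eventuallyEq (hs.add hd.norm) tendsto_const_nhds
      (hq.mono fun k hk => hk.2.1),
    fun i hi => ge_of_tendsto (hdi i) (hq.mono fun k hk => hk.2.2.1 i hi),
    fun i hi => tendsto_nhds_unique_of_eventuallyEq (hdi i) tendsto_const_nhds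
      (hq.mono fun k hk => hk.2.2.2.1 i hi),
    tendsto_nhds_unique_of_eventuallyEq (tendsto_finsetSum T fun i _ => (hdi i).smul (hv i))
      (hs.smul hb) (hq.mono fun k hk => hk.2.2.2.2)⟩

end Multipliers

/-! ### Feasibility of limit points. -/

namespace ParamConstraint

variable {X κ : Type*} {m p ℓ : ℕ}
  {h : Fin p → X → EuclideanSpace ℝ (Fin m) → ℝ}

theorem disjoint_ineqIdx_eqIdx : Disjoint (ineqIdx p ℓ) (eqIdx p ℓ) := by
  rw [Finset.disjoint_left]
  intro i hi hj
  simp only [ineqIdx, eqIdx, Finset.mem_filter] at hi hj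
  omega

theorem mem_ineqIdx_or_mem_eqIdx (i : Fin p) : i ∈ ineqIdx p ℓ ∨ i ∈ eqIdx p ℓ := by
  simp only [ineqIdx, eqIdx, Finset.mem_filter, Finset.mem_univ, true_and]
  omega

theorem isClosed_Gam {x : X} (hc : ∀ i, Continuous (h i x)) : IsClosed (Gam ℓ h x) := by
  simp only [Gam, ofPred_and, ofPred_forall]
  exact (isClosed_biInter fun i _ => isClosed_le (hc i) continuous_const).inter
    (isClosed_biInter fun i _ => isClosed_eq (hc i) continuous_const)

/-- Under the convexity assumption, limits of feasible points are feasible. -/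
theorem mem_Gam_of_tendsto [TopologicalSpace X] {l : Filter κ} [l.NeBot] {xbar : X}
    {W : Set (X × EuclideanSpace ℝ (Fin m))} (hW : IsOpen W)
    (hsub : {xbar} ×ˢ Gam ℓ h xbar ⊆ W)
    (hcont : ∀ i, ContinuousOn (fun z : X × EuclideanSpace ℝ (Fin m) => h i z.1 z.2) W)
    (hconv : ∀ x, ∀ i ∈ ineqIdx p ℓ, ConvexOn ℝ univ (fun y => h i x y))
    (haff : ∀ x, ∀ i ∈ eqIdx p ℓ,
      ∃ A : EuclideanSpace ℝ (Fin m) →ᵃ[ℝ] ℝ, ∀ y, h i x y = A y)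
    (hc : ∀ i, Continuous (h i xbar)) {ybar : EuclideanSpace ℝ (Fin m)}
    (hy : ybar ∈ Gam ℓ h xbar) {u : κ → X} (hu : Tendsto u l (𝓝 xbar))
    {w : κ → EuclideanSpace ℝ (Fin m)} {ws : EuclideanSpace ℝ (Fin m)}
    (hw : Tendsto w l (𝓝 ws)) (hwmem : ∀ᶠ k in l, w k ∈ Gam ℓ h (u k)) :
    ws ∈ Gam ℓ h xbar := by
  have hlim : ∀ (i : Fin p) {q : κ → EuclideanSpace ℝ (Fin m)} {qs}, Tendsto q l (𝓝 qs) →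
      (xbar, qs) ∈ W → Tendsto (fun k => h i (u k) (q k)) l (𝓝 (h i xbar qs)) :=
    fun i q qs hq hmem =>
      ((hcont i).continuousAt (hW.mem_nhds hmem)).tendsto.comp (hu.prodMk_nhds hq)
  have hyW : (xbar, ybar) ∈ W := hsub ⟨rfl, hy⟩
  have hline : Continuous (AffineMap.lineMap ybar ws : ℝ → EuclideanSpace ℝ (Fin m)) :=
    AffineMap.lineMap_continuous
  -- Continuity at `(xbar, ws)` is not yet available, as `ws` may lie outside the good neighborhood.
  -- Segment points inside `W` are feasible: bound `h i` there by its values at `ybar` and `w k`,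
  -- then let `u k → xbar`.
  have hkey : ∀ t ∈ Icc (0 : ℝ) 1, (xbar, AffineMap.lineMap ybar ws t) ∈ W →
      AffineMap.lineMap ybar ws t ∈ Gam ℓ h xbar := by
    intro t ht hmem
    have hq : Tendsto (fun k => AffineMap.lineMap ybar (w k) t) l
        (𝓝 (AffineMap.lineMap ybar ws t)) := by
      simp only [AffineMap.lineMap_apply_module]
      exact tendsto_const_nhds.add (hw.const_smul t)
    refine ⟨fun i hi => ?_, fun i hi => ?_⟩
    · have h1 : Tendsto (fun k => (1 - t) * h i (u k) ybar) l (𝓝 ((1 - t) * h i xbar ybar)) :=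
        (hlim i tendsto_const_nhds hyW).const_mul _
      refine (le_of_tendsto_of_tendsto (hlim i hq hmem) h1 ?_).trans
        (mul_nonpos_of_nonneg_of_nonpos (sub_nonneg.2 ht.2) (hy.1 i hi))
      filter_upwards [hwmem] with k hk
      have h2 := (hconv (u k) i hi).2 (mem_univ ybar) (mem_univ (w k)) (sub_nonneg.2 ht.2) ht.1
        (by ring)
      have h3 := mul_nonpos_of_nonneg_of_nonpos ht.1 (hk.1 i hi)
      rw [← AffineMap.lineMap_apply_module, smul_eq_mul, smul_eq_mul] at h2
      linarith
    · have h1 : Tendsto (fun k => (1 - t) * h i (u k) ybar) l (𝓝 ((1 - t) * h i xbar ybar)) :=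
        (hlim i tendsto_const_nhds hyW).const_mul _
      rw [hy.2 i hi, mul_zero] at h1
      refine tendsto_nhds_unique_of_eventuallyEq (hlim i hq hmem) h1 ?_
      filter_upwards [hwmem] with k hk
      obtain ⟨A, hA⟩ := haff (u k) i hi
      have h2 := hk.2 i hi
      rw [hA] at h2
      rw [hA, hA, AffineMap.apply_lineMap, h2, AffineMap.lineMap_apply_module]
      simp
  have hcl : IsClosed ((AffineMap.lineMap ybar ws : ℝ → _) ⁻¹' Gam ℓ h xbar) :=
    (isClosed_Gam hc).preimage hline
  -- The feasible parameters form a closed set containing `0`, and feasible points lie in the open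
  -- `W`, so the set can always be continued to the right and reaches `1`.
  have hsubset := (hcl.inter isClosed_Icc).Icc_subset_of_forall_mem_nhdsWithin
    (a := (0 : ℝ)) (b := 1) (by simpa using hy) (by
      rintro t ⟨ht, ht01⟩
      have hWt : ∀ᶠ t' in 𝓝 t, (xbar, AffineMap.lineMap ybar ws t') ∈ W :=
        (continuous_const.prodMk hline).continuousAt.eventually_mem
          (hW.mem_nhds (hsub ⟨rfl, ht⟩))
      filter_upwards [hWt.filter_mono nhdsWithin_le_nhds, Ioc_mem_nhdsGT ht01.2] with t' h1 h2
      exact hkey t' ⟨ht01.1.trans h2.1.le, h2.2⟩ h1)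
  simpa using hsubset (right_mem_Icc.2 zero_le_one)

end ParamConstraint

/-! ### Limits of penalized minimizers under RCPLD. -/

namespace ParamConstraint

variable {X κ : Type*} [TopologicalSpace X] {m p ℓ : ℕ}
  {h : Fin p → X → EuclideanSpace ℝ (Fin m) → ℝ}

/-- If `(∇_y h i)_{i ∈ S}` is a basis of the span of `(∇_y h i)_{i ∈ J}` at the limit point and
the latter family has locally constant rank, then the same holds nearby. -/
theorem eventually_basis_of_constant_rank {l : Filter κ} {v : κ → Fin p → EuclideanSpace ℝ (Fin m)}
    {vs : Fin p → EuclideanSpace ℝ (Fin m)}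
    (hv : ∀ i, Tendsto (fun k => v k i) l (𝓝 (vs i))) {S J : Finset (Fin p)} (hSJ : S ⊆ J)
    (hli : LinearIndependent ℝ fun i : S => vs i)
    (hspan : Submodule.span ℝ (range fun i : S => vs i) =
      Submodule.span ℝ (range fun i : J => vs i))
    (hrank : ∀ᶠ k in l, Module.finrank ℝ (Submodule.span ℝ (range fun i : J => v k i)) =
      Module.finrank ℝ (Submodule.span ℝ (range fun i : J => vs i))) :
    ∀ᶠ k in l, LinearIndepOn ℝ (v k) (S : Set (Fin p)) ∧
      ∀ i ∈ J, v k i ∈ Submodule.span ℝ (v k '' S) := by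
  have hvS : Tendsto (fun k (i : S) => v k i) l (𝓝 fun i : S => vs i) :=
    tendsto_pi_nhds.2 fun i => hv i
  filter_upwards [hvS.eventually hli.eventually, hrank] with k hk hr
  have hk' : LinearIndepOn ℝ (v k) (S : Set (Fin p)) := hk
  refine ⟨hk', ?_⟩
  have hle : Submodule.span ℝ (range fun i : S => v k i) ≤
      Submodule.span ℝ (range fun i : J => v k i) := by
    refine Submodule.span_mono ?_
    rintro _ ⟨i, rfl⟩
    exact ⟨⟨i, hSJ i.2⟩, rfl⟩
  have heq := Submodule.eq_of_le_of_finrank_eq hle (by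
    rw [hr, ← hspan, finrank_span_eq_card hk, finrank_span_eq_card hli])
  intro i hi
  rw [image_eq_range]
  change v k i ∈ Submodule.span ℝ (range fun i : S => v k i)
  rw [heq]
  exact Submodule.subset_span ⟨⟨i, hi⟩, rfl⟩

/-- Under RCPLD, limits of minimizers of the penalized problems for projecting a feasible point
`ybar` coincide with `ybar`. -/
theorem eq_of_tendsto_minimizers (l : Ultrafilter κ) {xbar : X}
    {W : Set (X × EuclideanSpace ℝ (Fin m))} (hW : IsOpen W)
    (hcont : ∀ i, ContinuousOn (fun z : X × EuclideanSpace ℝ (Fin m) => h i z.1 z.2) W)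
    (hdiff : ∀ i, ∀ z ∈ W, DifferentiableAt ℝ (fun y => h i z.1 y) z.2)
    (hgrad : ∀ i, ContinuousOn (fun z : X × EuclideanSpace ℝ (Fin m) => gradY h i z.1 z.2) W)
    (hconv : ∀ x, ∀ i ∈ ineqIdx p ℓ, ConvexOn ℝ univ (fun y => h i x y))
    (haff : ∀ x, ∀ i ∈ eqIdx p ℓ,
      ∃ A : EuclideanSpace ℝ (Fin m) →ᵃ[ℝ] ℝ, ∀ y, h i x y = A y)
    {ybar ws : EuclideanSpace ℝ (Fin m)} (hy : ybar ∈ Gam ℓ h xbar) (hws : ws ∈ Gam ℓ h xbar)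
    (hwsW : (xbar, ws) ∈ W) (hR : RCPLD ℓ h (dom (Gam ℓ h)) xbar ws)
    {u : κ → X} (hu : Tendsto u l (𝓝 xbar)) (hudom : ∀ k, u k ∈ dom (Gam ℓ h))
    {z : κ → EuclideanSpace ℝ (Fin m)} (hz : Tendsto z l (𝓝 ws)) {ρ : κ → ℝ}
    (hρ : ∀ k, 0 ≤ ρ k)
    (hmin : ∀ k, IsMinOn (fun y => ‖y - ybar‖ ^ 2 +
      ρ k * quadraticPenalty (ineqIdx p ℓ) (eqIdx p ℓ) (fun i => h i (u k)) y) univ (z k)) :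
    ws = ybar := by
  obtain ⟨U, hU, S, hSJ, ⟨hli, hspan⟩, ⟨r, hr⟩, hpos⟩ := hR
  have huz : Tendsto (fun k => (u k, z k)) l (𝓝 (xbar, ws)) := hu.prodMk_nhds hz
  have hWev : ∀ᶠ k in (l : Filter κ), (u k, z k) ∈ W := huz.eventually_mem (hW.mem_nhds hwsW)
  have hUev : ∀ᶠ k in (l : Filter κ), (u k, z k) ∈ U := huz.eventually_mem hU
  have hlim : ∀ i, Tendsto (fun k => h i (u k) (z k)) l (𝓝 (h i xbar ws)) := fun i =>
    ((hcont i).continuousAt (hW.mem_nhds hwsW)).tendsto.comp huz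
  have hv : ∀ i, Tendsto (fun k => gradY h i (u k) (z k)) l (𝓝 (gradY h i xbar ws)) := fun i =>
    ((hgrad i).continuousAt (hW.mem_nhds hwsW)).tendsto.comp huz
  have hbasis := eventually_basis_of_constant_rank (v := fun k i => gradY h i (u k) (z k))
    (vs := fun i => gradY h i xbar ws) hv hSJ hli hspan (by
      filter_upwards [hUev] with k hk
      rw [hr _ ⟨hk, hudom k, mem_univ _⟩, ← hr (xbar, ws) ⟨mem_of_mem_nhds hU, ⟨ws, hws⟩,
        mem_univ _⟩])
  have hmult : ∀ᶠ k in (l : Filter κ), ∃ K : Finset (Fin p), K ⊆ ineqIdx p ℓ ∧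
      (∀ i ∈ K, 0 < h i (u k) (z k)) ∧
      LinearIndepOn ℝ (fun i => gradY h i (u k) (z k)) ((K ∪ S : Finset (Fin p)) : Set (Fin p)) ∧
      ∃ d : Fin p → ℝ, (∀ i ∈ K, 0 ≤ d i) ∧ (∀ i ∉ K ∪ S, d i = 0) ∧
        ∑ i ∈ K ∪ S, d i • gradY h i (u k) (z k) = ybar - z k := by
    filter_upwards [hWev, hbasis] with k hk hb
    exact exists_multipliers_of_isMinOn_penalized (hρ k) disjoint_ineqIdx_eqIdx hSJ
      (fun i _ => hdiff i _ hk) (fun i _ => hdiff i _ hk) hb.1 hb.2 (hmin k)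
  -- There are finitely many index sets, so the ultrafilter selects one `K` valid for almost all
  -- `k`.
  obtain ⟨K, hK⟩ := Ultrafilter.eventually_exists_iff.1 hmult
  obtain ⟨k₀, ⟨hKI, -, hKli, -⟩, hk₀⟩ := (hK.and hUev).exists
  -- Constraints violated at `z k` have limit value at least `0`; feasibility of `ws` makes them
  -- active.
  have hact : (K : Set (Fin p)) ⊆ activeIdx ℓ h xbar ws := fun i hi =>
    ⟨hKI hi, le_antisymm (hws.1 i (hKI hi))
      (ge_of_tendsto (hlim i) (hK.mono fun k hk => (hk.2.1 i hi).le))⟩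
  have hdisj : Disjoint K S := disjoint_ineqIdx_eqIdx.mono hKI hSJ
  obtain ⟨s, d, hs, hsd, hd, hd0, hsum⟩ := exists_normalized_limit_multipliers l hv
    (tendsto_const_nhds.sub hz) (hK.mono fun k hk => hk.2.2.2)
  have hspos : 0 < s := by
    refine lt_of_le_of_ne hs fun h0 => ?_
    subst h0
    refine hpos K hact ⟨fun i => d i, fun i => d i, fun i => hd i i.2, ?_, ?_⟩ (u k₀, z k₀)
      ⟨hk₀, hudom k₀, mem_univ _⟩ hKli
    · by_contra! hcon
      have hdz : d = 0 := by
        funext i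
        by_cases hi : i ∈ K ∪ S
        · rcases Finset.mem_union.1 hi with hi | hi
          · exact congrFun hcon.1 ⟨i, hi⟩
          · exact congrFun hcon.2 ⟨i, hi⟩
        · exact hd0 i hi
      simp [hdz] at hsd
    · rw [Finset.sum_union hdisj, zero_smul] at hsum
      rw [Finset.sum_coe_sort K fun i => d i • gradY h i xbar ws,
        Finset.sum_coe_sort S fun i => d i • gradY h i xbar ws, hsum]
  have hle : ∀ i ∈ K ∪ S, d i * inner ℝ (gradY h i xbar ws) (ybar - ws) ≤ 0 := by
    intro i hi
    rcases Finset.mem_union.1 hi with hi | hi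
    · refine mul_nonpos_of_nonneg_of_nonpos (hd i hi) ?_
      have h1 := (hconv xbar i (hKI hi)).inner_gradient_le (hdiff i _ hwsW) ybar
      have h2 := hy.1 i (hKI hi)
      have h3 : h i xbar ws = 0 := (hact hi).2
      exact h1.trans (by linarith)
    · obtain ⟨A, hA⟩ := haff xbar i (hSJ hi)
      have hAeq : (fun y => h i xbar y) = A := funext hA
      have h1 := (hdiff i _ hwsW).hasGradientAt.hasFDerivAt.hasLineDerivAt (ybar - ws)
      have h2 : h i xbar ybar - h i xbar ws = 0 := by
        rw [hy.2 i (hSJ hi), hws.2 i (hSJ hi), sub_self]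
      -- An affine function vanishing at both `ws` and `ybar` is constant on the line through them.
      have h3 : HasLineDerivAt ℝ (fun y => h i xbar y) 0 ws (ybar - ws) := by
        unfold HasLineDerivAt
        have h4 : (fun t : ℝ => h i xbar (ws + t • (ybar - ws))) = fun _ => h i xbar ws := by
          funext t
          have h5 := A.apply_lineMap ws ybar t
          rw [← hA, ← hA, ← hA, AffineMap.lineMap_apply, AffineMap.lineMap_apply, vsub_eq_sub,
            vadd_eq_add, vsub_eq_sub, vadd_eq_add, h2, smul_zero, zero_add, add_comm] at h5
          exact h5
        rw [h4]
        exact hasDerivAt_const _ _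
      have h6 := h1.unique h3
      rw [InnerProductSpace.toDual_apply_apply] at h6
      exact (mul_eq_zero_of_right _ h6).le
  have hfin : s * ‖ybar - ws‖ ^ 2 ≤ 0 := by
    calc s * ‖ybar - ws‖ ^ 2 = inner ℝ (s • (ybar - ws)) (ybar - ws) := by
          rw [real_inner_smul_left, real_inner_self_eq_norm_sq]
      _ = ∑ i ∈ K ∪ S, d i * inner ℝ (gradY h i xbar ws) (ybar - ws) := by
          rw [← hsum, sum_inner]
          exact Finset.sum_congr rfl fun i _ => real_inner_smul_left _ _ _
      _ ≤ 0 := Finset.sum_nonpos hle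
  have hnorm : ‖ybar - ws‖ ^ 2 ≤ 0 := nonpos_of_mul_nonpos_right hfin hspos
  have hzero : ‖ybar - ws‖ = 0 := pow_eq_zero_iff two_ne_zero |>.1 (hnorm.antisymm (sq_nonneg _))
  exact (sub_eq_zero.1 (norm_eq_zero.1 hzero)).symm

end ParamConstraint

/-! ### Lower semicontinuity of the feasible-set mapping. -/

theorem mainTheorem10 (n m p ℓ : ℕ) (hℓ : ℓ ≤ p)
    (h : Fin p → EuclideanSpace ℝ (Fin n) → EuclideanSpace ℝ (Fin m) → ℝ)
    (xbar : EuclideanSpace ℝ (Fin n))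
    (hxbar : xbar ∈ ParamConstraint.dom (ParamConstraint.Gam ℓ h))
    (hsmooth : ParamConstraint.SmoothInYNear h ({xbar} ×ˢ ParamConstraint.Gam ℓ h xbar))
    (hconvex : ∀ x, ∀ i ∈ ParamConstraint.ineqIdx p ℓ,
      ConvexOn ℝ Set.univ (fun y => h i x y))
    (haffine : ∀ x, ∀ i ∈ ParamConstraint.eqIdx p ℓ,
      ∃ A : EuclideanSpace ℝ (Fin m) →ᵃ[ℝ] ℝ, ∀ y, h i x y = A y)
    (hbounded : ParamConstraint.LocallyBoundedAt (ParamConstraint.Gam ℓ h) xbar)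
    (hRCPLD : ∀ y ∈ ParamConstraint.Gam ℓ h xbar,
      ParamConstraint.RCPLD ℓ h (ParamConstraint.dom (ParamConstraint.Gam ℓ h)) xbar y) :
    LowerHemicontinuousWithinAt (ParamConstraint.Gam ℓ h)
      (ParamConstraint.dom (ParamConstraint.Gam ℓ h)) xbar := by
  rw [lowerHemicontinuousWithinAt_iff]
  rintro O hO ⟨ybar, hy, hyO⟩
  by_contra hcon
  rw [not_eventually] at hcon
  obtain ⟨u, hu, hbad⟩ := exists_seq_forall_of_frequently (hcon.and_eventually self_mem_nhdsWithin)
  -- Finite-dimensional convexity gives continuity in `y` on the whole space, where the penalty is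
  -- minimized, not just near the feasible set.
  have hcts : ∀ x i, Continuous (h i x) := by
    intro x i
    rcases ParamConstraint.mem_ineqIdx_or_mem_eqIdx (ℓ := ℓ) i with hi | hi
    · exact (hconvex x i hi).locallyLipschitz.continuous
    · obtain ⟨A, hA⟩ := haffine x i hi
      rw [show h i x = A from funext hA]
      exact A.continuous_of_finiteDimensional
  obtain ⟨W, hW, hsub, hWh⟩ := hsmooth
  obtain ⟨B, hB, V, hV, hVB⟩ := hbounded
  have hpen : ∀ k : ℕ, _ := fun k =>
    exists_isMinOn_penalized (I := ParamConstraint.ineqIdx p ℓ) (J := ParamConstraint.eqIdx p ℓ)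
      (f := fun i => h i (u k)) (fun i _ => hcts _ i) (fun i _ => hcts _ i) ybar (hbad k).2
      (Nat.one_div_pos_of_nat (α := ℝ) (n := k))
  choose ρ hρ z w hmin hw hzw using hpen
  have hu' : Tendsto u (hyperfilter ℕ) (𝓝 xbar) :=
    (hu.mono_right nhdsWithin_le_nhds).mono_left Nat.hyperfilter_le_atTop
  have hwB : ∀ᶠ k in (hyperfilter ℕ : Filter ℕ), w k ∈ closure B := by
    filter_upwards [hu'.eventually_mem hV] with k hk
    exact subset_closure (hVB _ hk (hw k))
  obtain ⟨ws, -, hws⟩ := hB.isCompact_closure.ultrafilter_le_nhds ((hyperfilter ℕ).map w)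
    (le_principal_iff.2 hwB)
  have hwlim : Tendsto w (hyperfilter ℕ) (𝓝 ws) := hws
  have hzlim : Tendsto z (hyperfilter ℕ) (𝓝 ws) := by
    refine (tendsto_iff_of_dist ?_).2 hwlim
    exact squeeze_zero (fun _ => dist_nonneg) (fun k => (hzw k).le)
      (tendsto_one_div_add_atTop_nhds_zero_nat.mono_left Nat.hyperfilter_le_atTop)
  have hwsG : ws ∈ ParamConstraint.Gam ℓ h xbar :=
    ParamConstraint.mem_Gam_of_tendsto hW hsub (fun i => (hWh i).1) hconvex haffine (hcts xbar) hy
      hu' hwlim (Eventually.of_forall hw)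
  have heq : ws = ybar := ParamConstraint.eq_of_tendsto_minimizers (hyperfilter ℕ) hW
    (fun i => (hWh i).1) (fun i => (hWh i).2.1) (fun i => (hWh i).2.2) hconvex haffine hy hwsG
    (hsub ⟨rfl, hwsG⟩) (hRCPLD ws hwsG) hu' (fun k => (hbad k).2) hzlim hρ hmin
  obtain ⟨k, hk⟩ := (hwlim.eventually_mem (hO.mem_nhds (heq ▸ hyO))).exists
  exact (hbad k).1 ⟨w k, hw k, hk⟩
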